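/- For a linear subspace $H \subset \mathbb{R}^n$ of dimension $k$, let $F(H) = \mathrm{vol}_k\left([0,1]^n \,|\, H\right)$ denote the $k$-dimensional volume of the orthogonal projection of the cube $[0,1]^n$ onto $H$. Fix $q \in \mathbb{N}$. For every $n \ge q$, let $H_{n-q}$ be a maximizer of $F$ among all $(n-q)$-dimensional linear subspaces of $\mathbb{R}^n$, and let $M_n$ and $m_n$ be the maximum and the minimum, respectively, of the lengths of the orthogonal projections onto $H_{n-q}$ of the standard basis vectors $e_1, \dots, e_n$ of $\mathbb{R}^n$. Then $$\frac{m_n}{M_n} \to 1 \qquad \text{as } n \to \infty.$$ -/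

import Mathlib

open Filter Topology MeasureTheory

/-- The cube `[0,1]^n` in Euclidean space `ℝⁿ`. -/
def unitCube (n : ℕ) : Set (EuclideanSpace ℝ (Fin n)) :=
  {x | ∀ i, x i ∈ Set.Icc (0 : ℝ) 1}

/-- The `k`-dimensional volume, `k = dim H`, of the orthogonal projection of `[0,1]^n` onto the
linear subspace `H`. The measure on `H` is the Lebesgue measure that the inner product of `H`
determines (an orthonormal basis of `H` spans a box of volume `1`). -/
noncomputable def cubeProjVolume {n : ℕ} (H : Submodule ℝ (EuclideanSpace ℝ (Fin n))) : ENNReal :=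
  volume (H.orthogonalProjectionOnto '' unitCube n)

/-- `H` is a (global) maximizer of the volume of the projection of `[0,1]^n` among all
`k`-dimensional linear subspaces of `ℝⁿ`. -/
def IsCubeProjMaximizer {n : ℕ} (k : ℕ) (H : Submodule ℝ (EuclideanSpace ℝ (Fin n))) : Prop :=
  Module.finrank ℝ H = k ∧
    ∀ H' : Submodule ℝ (EuclideanSpace ℝ (Fin n)), Module.finrank ℝ H' = k →
      cubeProjVolume H' ≤ cubeProjVolume H

/-- The length of the orthogonal projection onto `H` of the standard basis vector `e_i`. -/
noncomputable def projBasisLength {n : ℕ} (H : Submodule ℝ (EuclideanSpace ℝ (Fin n)))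
    (i : Fin n) : ℝ :=
  ‖H.orthogonalProjectionOnto (EuclideanSpace.single i (1 : ℝ))‖

/-- The minimum length of the projections of the standard basis vectors onto `H`. -/
noncomputable def minProjLength {n : ℕ} (H : Submodule ℝ (EuclideanSpace ℝ (Fin n))) : ℝ :=
  ⨅ i : Fin n, projBasisLength H i

/-- The maximum length of the projections of the standard basis vectors onto `H`. -/
noncomputable def maxProjLength {n : ℕ} (H : Submodule ℝ (EuclideanSpace ℝ (Fin n))) : ℝ :=
  ⨆ i : Fin n, projBasisLength H i

/-! Let V(k, n) be the maximal k-dimensional shadow volume of the n-cube, encoded by matrices with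
orthonormal rows, and let C_p(k) = V(k, k + p). Rotating one column onto the first axis exhibits the
cube's image as a convex body swept along a segment. Hence (`cubeImageVolume_le_column_norm`) a
maximizer whose j-th basis vector projects to length ℓ satisfies V(k+1, n+1) ≤ ℓ V(k, n) + V(k+1,
n). Since V(k, n) ≤ V(k+1, n+1), this gives ℓ ≥ 1 - V(k+1, n) / V(k, n). As ℓ ≤ 1, it remains to
show that this quotient, which compares codimension q - 1 with codimension q, tends to 0.

Two facts give this. Tilting rows repeatedly yields √m C_p(k+1) ≤ C_{p+1}(k+m)
(`sqrt_mul_maxCubeImageVolume_le`). If C_p(k+1)/C_p(k) → 1, then C_p(k+1+m) is close to C_p(k+1) for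
fixed m, so C_p(k+1)/C_{p+1}(k) → 0. The sweep inequality then bounds C_{p+1}(k+1)/C_{p+1}(k) by 1
plus that quotient, and induction on p closes the loop. -/

/-- Sweeping a compact convex set along a segment of length `a` adds `a` times the volume of its
shadow. -/
theorem volume_segment_sweep {k : ℕ} {K : Set (ℝ × (Fin k → ℝ))} (hK : IsCompact K)
    (hc : Convex ℝ K) {a : ℝ} (ha : 0 ≤ a) :
    volume ((fun p : ℝ × ℝ × (Fin k → ℝ) => (p.1 + p.2.1, p.2.2)) '' (Set.Icc 0 a ×ˢ K)) =
      ENNReal.ofReal a * volume (Prod.snd '' K) + volume K := by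
  set S := (fun p : ℝ × ℝ × (Fin k → ℝ) => (p.1 + p.2.1, p.2.2)) '' (Set.Icc 0 a ×ˢ K) with hS
  have hSc : IsCompact S := (isCompact_Icc.prod hK).image (by fun_prop)
  have hPc : IsCompact (Prod.snd '' K) := hK.image continuous_snd
  rw [Measure.volume_eq_prod, Measure.prod_apply_symm hSc.measurableSet,
    Measure.prod_apply_symm hK.measurableSet, ← lintegral_indicator_const hPc.measurableSet,
    ← lintegral_add_left (measurable_const.indicator hPc.measurableSet)]
  refine lintegral_congr fun y => ?_
  have hfib : (fun x => (x, y)) ⁻¹' S =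
      (fun p : ℝ × ℝ => p.1 + p.2) '' (Set.Icc 0 a ×ˢ ((fun x : ℝ => (x, y)) ⁻¹' K)) := by
    ext s
    constructor
    · rintro ⟨⟨t, u, z⟩, ⟨ht, hu⟩, he⟩
      obtain ⟨h1, h2⟩ := Prod.mk.inj he
      simp only at h1 h2
      subst h2
      exact ⟨(t, u), ⟨ht, hu⟩, h1⟩
    · rintro ⟨⟨t, u⟩, ⟨ht, hu⟩, rfl⟩
      exact ⟨(t, u, y), ⟨ht, hu⟩, rfl⟩
  rw [hfib]
  -- Over the shadow the fibre of `K` is a compact interval, and the sweep lengthens it by exactly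
  -- `a`.
  by_cases hy : y ∈ Prod.snd '' K
  · have hne : ((fun x : ℝ => (x, y)) ⁻¹' K).Nonempty := by
      obtain ⟨⟨x, z⟩, hx, rfl⟩ := hy
      exact ⟨x, hx⟩
    have hcomp : IsCompact ((fun x : ℝ => (x, y)) ⁻¹' K) := by
      have hcl : IsClosed ((fun x : ℝ => (x, y)) ⁻¹' K) :=
        hK.isClosed.preimage (by fun_prop)
      refine (hK.image continuous_fst).of_isClosed_subset hcl fun x hx => ⟨(x, y), hx, rfl⟩
    have hconv : Convex ℝ ((fun x : ℝ => (x, y)) ⁻¹' K) := by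
      intro u hu v hv s t hs ht hst
      have := hc hu hv hs ht hst
      simpa [← add_smul, hst] using this
    obtain ⟨l, r, hlr⟩ : ∃ l r, (fun x : ℝ => (x, y)) ⁻¹' K = Set.Icc l r :=
      ⟨_, _, eq_Icc_of_connected_compact ⟨hne, hconv.isPreconnected⟩ hcomp⟩
    rw [hlr] at hne ⊢
    have hle : l ≤ r := Set.nonempty_Icc.1 hne
    have himg : (fun p : ℝ × ℝ => p.1 + p.2) '' (Set.Icc 0 a ×ˢ Set.Icc l r) =
        Set.Icc l (r + a) := by
      ext s
      constructor
      · rintro ⟨⟨t, u⟩, ⟨⟨h1, h2⟩, h3, h4⟩, rfl⟩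
        simp only at *
        constructor <;> linarith
      · rintro ⟨h1, h2⟩
        refine ⟨(s - min s r, min s r), ⟨⟨?_, ?_⟩, ?_, ?_⟩, by simp⟩
        · simp
        · rcases min_cases s r with h | h <;> simp only [h] <;> linarith
        · exact le_min h1 hle
        · exact min_le_right _ _
    rw [himg, Set.indicator_of_mem hy, Real.volume_Icc, Real.volume_Icc,
      ← ENNReal.ofReal_add ha (by linarith)]
    congr 1; ring
  · have : (fun x : ℝ => (x, y)) ⁻¹' K = ∅ := by
      ext x
      simp only [Set.mem_preimage, Set.mem_empty_iff_false, iff_false]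
      exact fun h => hy ⟨_, h, rfl⟩
    simp [this, Set.indicator_of_notMem hy]

/-! ### Cube images under matrices with orthonormal rows -/

/-- The volume of the image of the cube `[0,1]^n` under a matrix. -/
noncomputable def cubeImageVolume {k n : ℕ} (A : Matrix (Fin k) (Fin n) ℝ) : ENNReal :=
  volume (A.mulVec '' Set.Icc 0 1)

/-- The largest volume of the image of the cube under a `k × n` matrix with orthonormal rows. -/
noncomputable def maxCubeImageVolume (k n : ℕ) : ENNReal :=
  ⨆ (A : Matrix (Fin k) (Fin n) ℝ) (_ : A * A.transpose = 1), cubeImageVolume A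

theorem cubeImageVolume_le_max {k n : ℕ} {A : Matrix (Fin k) (Fin n) ℝ}
    (hA : A * A.transpose = 1) : cubeImageVolume A ≤ maxCubeImageVolume k n :=
  le_iSup₂ (f := fun (A : Matrix (Fin k) (Fin n) ℝ) (_ : A * A.transpose = 1) =>
    cubeImageVolume A) A hA

theorem cubeImageVolume_mul {k n : ℕ} (M : Matrix (Fin k) (Fin k) ℝ)
    (A : Matrix (Fin k) (Fin n) ℝ) :
    cubeImageVolume (M * A) = ENNReal.ofReal |M.det| * cubeImageVolume A := by
  have : (M * A).mulVec '' Set.Icc 0 1 = Matrix.toLin' M '' (A.mulVec '' Set.Icc 0 1) := by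
    rw [Set.image_image]
    simp [Matrix.mulVec_mulVec]
  rw [cubeImageVolume, this, Measure.addHaar_image_linearMap, LinearMap.det_toLin']
  rfl

theorem cubeImageVolume_submatrix_equiv {k n : ℕ} (A : Matrix (Fin k) (Fin n) ℝ)
    (σ : Fin n ≃ Fin n) : cubeImageVolume (A.submatrix id σ) = cubeImageVolume A := by
  rw [cubeImageVolume, cubeImageVolume]
  congr 1
  ext y
  constructor
  · rintro ⟨x, hx, rfl⟩
    refine ⟨x ∘ σ.symm, ⟨fun i => hx.1 (σ.symm i), fun i => hx.2 (σ.symm i)⟩, ?_⟩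
    rw [Matrix.submatrix_mulVec_equiv]; rfl
  · rintro ⟨x, hx, rfl⟩
    refine ⟨x ∘ σ, ⟨fun i => hx.1 (σ i), fun i => hx.2 (σ i)⟩, ?_⟩
    rw [Matrix.submatrix_mulVec_equiv]
    ext i
    simp [Function.comp_assoc]

theorem Matrix.abs_det_of_mul_transpose_eq_one {k : ℕ} {M : Matrix (Fin k) (Fin k) ℝ}
    (h : M * M.transpose = 1) : |M.det| = 1 := by
  have := congrArg Matrix.det h
  rw [Matrix.det_mul, Matrix.det_transpose, Matrix.det_one, ← abs_mul_abs_self] at this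
  nlinarith [abs_nonneg M.det]

/-- Matrices with orthonormal rows and the same row space have cube images of equal volume. -/
theorem cubeImageVolume_eq_of_gram_eq {k n : ℕ} {A B : Matrix (Fin k) (Fin n) ℝ}
    (hA : A * A.transpose = 1) (h : A.transpose * A = B.transpose * B) : cubeImageVolume A = cubeImageVolume B := by
  have h1 : (A * B.transpose) * B = A := by
    rw [Matrix.mul_assoc, ← h, ← Matrix.mul_assoc, hA, Matrix.one_mul]
  have h2 : (A * B.transpose) * (A * B.transpose).transpose = 1 := by
    rw [Matrix.transpose_mul, Matrix.transpose_transpose, ← Matrix.mul_assoc, h1, hA]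
  rw [← h1, cubeImageVolume_mul, Matrix.abs_det_of_mul_transpose_eq_one h2]
  simp

/-! ### Expansion along a column -/

theorem cubeImageVolume_eq_prod {k n : ℕ} (A : Matrix (Fin (k + 1)) (Fin n) ℝ) :
    cubeImageVolume A = volume ((fun x : Fin n → ℝ =>
      (A.mulVec x 0, (A.submatrix Fin.succ id).mulVec x)) '' Set.Icc 0 1) := by
  have hmp := volume_preserving_piFinSuccAbove (fun _ : Fin (k + 1) => ℝ) 0
  rw [cubeImageVolume, ← hmp.symm.measure_preimage_equiv]
  congr 1
  rw [← MeasurableEquiv.image_eq_preimage_symm, Set.image_image]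
  rfl

/-- Column 0 lies on the first axis, so the image is the image under the other columns swept along
that axis; its shadow is given by the remaining rows. -/
theorem cubeImageVolume_expand {k n : ℕ} (A : Matrix (Fin (k + 1)) (Fin (n + 1)) ℝ)
    (h : ∀ i : Fin k, A i.succ 0 = 0) (h0 : 0 ≤ A 0 0) :
    cubeImageVolume A = ENNReal.ofReal (A 0 0) * cubeImageVolume (A.submatrix Fin.succ Fin.succ) +
      cubeImageVolume (A.submatrix id Fin.succ) := by
  have hlin : IsLinearMap ℝ (fun x : Fin n → ℝ => ((A.submatrix id Fin.succ).mulVec x 0,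
      ((A.submatrix id Fin.succ).submatrix Fin.succ id).mulVec x)) := by
    constructor
    · intro x y; simp [Matrix.mulVec_add]
    · intro c x; simp [Matrix.mulVec_smul]
  have hcont : Continuous (fun x : Fin n → ℝ => ((A.submatrix id Fin.succ).mulVec x 0,
      ((A.submatrix id Fin.succ).submatrix Fin.succ id).mulVec x)) :=
    LinearMap.continuous_of_finiteDimensional hlin.mk'
  rw [cubeImageVolume_eq_prod A, cubeImageVolume_eq_prod (A.submatrix id Fin.succ)]
  have hs := volume_segment_sweep (isCompact_Icc.image hcont)
    ((convex_Icc (0 : Fin n → ℝ) 1).is_linear_image hlin) h0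
  rw [Set.image_image] at hs
  refine Eq.trans ?_ hs
  congr 1
  ext ⟨s, y⟩
  constructor
  · rintro ⟨x, hx, he⟩
    refine ⟨(A 0 0 * x 0, _), ⟨⟨mul_nonneg h0 (hx.1 0), ?_⟩,
      ⟨fun i => x i.succ, ⟨fun i => hx.1 _, fun i => hx.2 _⟩, rfl⟩⟩, ?_⟩
    · exact mul_le_of_le_one_right h0 (hx.2 0)
    · rw [← he]
      ext i <;> simp [Matrix.mulVec, dotProduct, Fin.sum_univ_succ, h]
  · rintro ⟨⟨t, p⟩, ⟨⟨ht0, ht1⟩, ⟨x, hx, rfl⟩⟩, he⟩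
    -- If `A 0 0 = 0` then `t = 0` too, and the default value `t / 0 = 0` still works.
    refine ⟨Fin.cons (t / A 0 0) x, ⟨?_, ?_⟩, ?_⟩
    · intro i
      refine Fin.cases ?_ (fun i => ?_) i
      · exact div_nonneg ht0 h0
      · exact hx.1 i
    · intro i
      refine Fin.cases ?_ (fun i => ?_) i
      · exact div_le_one_of_le₀ ht1 h0
      · exact hx.2 i
    · have ht : A 0 0 * (t / A 0 0) = t := by
        rcases h0.eq_or_lt with h00 | h00
        · simp only at ht0 ht1
          rw [← h00] at ht1 ⊢
          linarith
        · field_simp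
      rw [← he]
      ext i <;> simp [Matrix.mulVec, dotProduct, Fin.sum_univ_succ, h, ht]

theorem Matrix.mul_transpose_eq_one_iff {k n : ℕ} {A : Matrix (Fin k) (Fin n) ℝ} :
    A * A.transpose = 1 ↔ ∀ i j, ∑ l, A i l * A j l = if i = j then 1 else 0 := by
  simp [← Matrix.ext_iff, Matrix.mul_apply, Matrix.one_apply]

/-- Replacing the first row of a matrix with orthonormal rows by a shorter row in the same
orthogonal position does not push the volume above the maximum. -/
theorem cubeImageVolume_le_max_of_head {k n : ℕ} {A : Matrix (Fin (k + 1)) (Fin n) ℝ}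
    (h0 : ∑ l, A 0 l * A 0 l ≤ 1) (h1 : ∀ i : Fin k, ∑ l, A 0 l * A i.succ l = 0)
    (h2 : ∀ i j : Fin k, ∑ l, A i.succ l * A j.succ l = if i = j then 1 else 0) :
    cubeImageVolume A ≤ maxCubeImageVolume (k + 1) n := by
  set c := √(∑ l, A 0 l * A 0 l) with hc
  have hnn : 0 ≤ ∑ l, A 0 l * A 0 l := Finset.sum_nonneg fun l _ => mul_self_nonneg _
  have hcc : c * c = ∑ l, A 0 l * A 0 l := Real.mul_self_sqrt hnn
  have hc1 : c ≤ 1 := Real.sqrt_le_one.2 h0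
  have hdet : ∀ x : ℝ, (Matrix.diagonal (Fin.cons x (fun _ : Fin k => (1 : ℝ)) :
      Fin (k + 1) → ℝ)).det = x := by
    intro x
    simp [Matrix.det_diagonal, Fin.prod_univ_succ]
  -- `A'` normalizes the first row. When `c = 0` that row vanishes, the factorization below
  -- survives, and the volume is zero.
  set A' : Matrix (Fin (k + 1)) (Fin n) ℝ :=
    Matrix.diagonal (Fin.cons c⁻¹ (fun _ : Fin k => (1 : ℝ)) : Fin (k + 1) → ℝ) * A with hA'
  have hz : c = 0 → ∀ l, A 0 l = 0 := by
    intro h l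
    rw [h, zero_mul, eq_comm, Finset.sum_eq_zero_iff_of_nonneg fun l _ => mul_self_nonneg _] at hcc
    exact mul_self_eq_zero.1 (hcc l (Finset.mem_univ _))
  have hA : A = Matrix.diagonal (Fin.cons c (fun _ : Fin k => (1 : ℝ)) : Fin (k + 1) → ℝ) * A' := by
    ext i l
    rw [hA', Matrix.diagonal_mul, Matrix.diagonal_mul]
    refine Fin.cases ?_ (fun i => ?_) i
    · by_cases h : c = 0
      · simp [h, hz h l]
      · simp [h]
    · simp
  rw [hA, cubeImageVolume_mul, hdet, abs_of_nonneg (Real.sqrt_nonneg _)]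
  rw [← hc]
  by_cases h : c = 0
  · rw [h]; simp
  have horth : A' * A'.transpose = 1 := by
    rw [Matrix.mul_transpose_eq_one_iff]
    intro i j
    refine Fin.cases ?_ (fun i => ?_) i <;> refine Fin.cases ?_ (fun j => ?_) j
    · simp only [hA', Matrix.diagonal_mul, Fin.cons_zero, if_true]
      have : ∀ l, c⁻¹ * A 0 l * (c⁻¹ * A 0 l) = (c⁻¹ * c⁻¹) * (A 0 l * A 0 l) := fun l => by ring
      simp_rw [this, ← Finset.mul_sum, ← hcc]
      field_simp
    · simp only [hA', Matrix.diagonal_mul, Fin.cons_zero, Fin.cons_succ, one_mul, mul_assoc,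
        ← Finset.mul_sum, h1, mul_zero]
      simp [(Fin.succ_ne_zero j).symm]
    · simp only [hA', Matrix.diagonal_mul, Fin.cons_zero, Fin.cons_succ, one_mul,
        mul_comm (A i.succ _), mul_assoc, ← Finset.mul_sum, h1, mul_zero]
      simp [Fin.succ_ne_zero i]
    · simp [hA', Matrix.diagonal_mul, h2]
  calc ENNReal.ofReal c * cubeImageVolume A' ≤ 1 * cubeImageVolume A' := by
        gcongr; exact ENNReal.ofReal_le_one.2 hc1
    _ ≤ _ := by rw [one_mul]; exact cubeImageVolume_le_max horth

theorem cubeImageVolume_le_of_column {k n : ℕ} {A : Matrix (Fin (k + 1)) (Fin (n + 1)) ℝ}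
    (hA : A * A.transpose = 1) (h : ∀ i : Fin k, A i.succ 0 = 0) (h0 : 0 ≤ A 0 0) :
    cubeImageVolume A ≤ ENNReal.ofReal (A 0 0) * maxCubeImageVolume k n +
      maxCubeImageVolume (k + 1) n := by
  rw [cubeImageVolume_expand A h h0]
  rw [Matrix.mul_transpose_eq_one_iff] at hA
  have h2 (i j : Fin k) : ∑ l : Fin n, A i.succ l.succ * A j.succ l.succ =
      if i = j then 1 else 0 := by
    have := hA i.succ j.succ
    rw [Fin.sum_univ_succ] at this
    simpa [h] using this
  gcongr
  · apply cubeImageVolume_le_max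
    rw [Matrix.mul_transpose_eq_one_iff]
    exact h2
  · apply cubeImageVolume_le_max_of_head
    · have := hA 0 0
      rw [Fin.sum_univ_succ] at this
      simp only [if_true] at this
      simp only [Matrix.submatrix_apply, id]
      nlinarith [mul_self_nonneg (A 0 0)]
    · intro i
      have := hA 0 i.succ
      rw [Fin.sum_univ_succ] at this
      simpa [h, (Fin.succ_ne_zero i).symm] using this
    · exact h2

theorem Matrix.exists_orthogonal_mulVec_eq {k : ℕ} (u : Fin (k + 1) → ℝ) :
    ∃ M : Matrix (Fin (k + 1)) (Fin (k + 1)) ℝ, M * M.transpose = 1 ∧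
      (M.mulVec u) 0 = √(∑ i, u i ^ 2) ∧ ∀ i : Fin k, (M.mulVec u) i.succ = 0 := by
  set x : EuclideanSpace ℝ (Fin (k + 1)) := WithLp.toLp 2 u with hx
  have hn : ‖x‖ = √(∑ i, u i ^ 2) := by simp [EuclideanSpace.norm_eq, hx]
  by_cases h0 : x = 0
  · have hu : u = 0 := by simpa [hx] using h0
    exact ⟨1, by simp, by simp [hu], by simp [hu]⟩
  have hv : Orthonormal ℝ (({0} : Set (Fin (k + 1))).domRestrict fun _ => ‖x‖⁻¹ • x) :=
    ⟨fun i => by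
      simp only [Set.domRestrict_apply]
      exact norm_smul_inv_norm (𝕜 := ℝ) h0,
    fun i j h => absurd (Subsingleton.elim i j) h⟩
  obtain ⟨b, hb⟩ := hv.exists_orthonormalBasis_extension_of_card_eq (by simp)
  have hb0 : b 0 = ‖x‖⁻¹ • x := hb 0 rfl
  have hx0 : x = ‖x‖ • b 0 := by
    rw [hb0, smul_smul, mul_inv_cancel₀ (norm_ne_zero_iff.2 h0), one_smul]
  have hM (i : Fin (k + 1)) (y : EuclideanSpace ℝ (Fin (k + 1))) :
      inner ℝ (b i) y = ∑ l, b i l * y l := by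
    simp [PiLp.inner_apply, mul_comm]
  have hMu (i : Fin (k + 1)) : (Matrix.of fun i l => b i l).mulVec u i = inner ℝ (b i) x := by
    rw [hM]; rfl
  refine ⟨Matrix.of fun i l => b i l, ?_, ?_, fun i => ?_⟩
  · rw [Matrix.mul_transpose_eq_one_iff]
    intro i j
    simp only [Matrix.of_apply, ← hM]
    exact orthonormal_iff_ite.1 b.orthonormal i j
  · rw [hMu, ← hn, hx0, inner_smul_right, orthonormal_iff_ite.1 b.orthonormal]
    simp [norm_smul]
  · rw [hMu, hx0, inner_smul_right, orthonormal_iff_ite.1 b.orthonormal]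
    simp [Fin.succ_ne_zero]

/-- The cube image volume is controlled by the length of any single column. -/
theorem cubeImageVolume_le_column_norm {k n : ℕ} {A : Matrix (Fin (k + 1)) (Fin (n + 1)) ℝ}
    (hA : A * A.transpose = 1) (j : Fin (n + 1)) :
    cubeImageVolume A ≤ ENNReal.ofReal √(∑ i, A i j ^ 2) * maxCubeImageVolume k n +
      maxCubeImageVolume (k + 1) n := by
  obtain ⟨M, hM, h0, hs⟩ := Matrix.exists_orthogonal_mulVec_eq fun i => A i j
  -- Rotating the target and permuting the coordinates preserve the volume and put column `j` on the
  -- first axis.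
  set B := (M * A).submatrix id (Equiv.swap 0 j) with hB
  have hcol (i) : B i 0 = M.mulVec (fun i => A i j) i := by
    simp [hB, Matrix.mul_apply, Matrix.mulVec, dotProduct]
  have hV : cubeImageVolume B = cubeImageVolume A := by
    rw [hB, cubeImageVolume_submatrix_equiv, cubeImageVolume_mul,
      Matrix.abs_det_of_mul_transpose_eq_one hM]
    simp
  have hBB : B * B.transpose = 1 := by
    rw [hB, Matrix.transpose_submatrix, Matrix.submatrix_mul_equiv, Matrix.transpose_mul,
      Matrix.mul_assoc, ← Matrix.mul_assoc A, hA, Matrix.one_mul, hM, Matrix.submatrix_id_id]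
  rw [← hV]
  have := cubeImageVolume_le_of_column hBB (fun i => by rw [hcol, hs])
    (by rw [hcol, h0]; positivity)
  rwa [hcol, h0] at this

theorem sum_sq_column_le_one {k n : ℕ} {A : Matrix (Fin k) (Fin n) ℝ}
    (hA : A * A.transpose = 1) (j : Fin n) : ∑ i, A i j ^ 2 ≤ 1 := by
  set s := ∑ i, A i j ^ 2 with hs
  have hP : (A.transpose * A) * (A.transpose * A) = A.transpose * A := by
    rw [Matrix.mul_assoc, ← Matrix.mul_assoc A, hA, Matrix.one_mul]
  have h := congrFun (congrFun hP j) j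
  have hjj : (A.transpose * A) j j = s := by
    simp [Matrix.mul_apply, hs, sq]
  rw [Matrix.mul_apply, hjj] at h
  have hsym (l) : (A.transpose * A) l j = (A.transpose * A) j l := by
    simp [Matrix.mul_apply, mul_comm]
  simp_rw [hsym] at h
  -- `s` is a diagonal entry of the projection `AᵀA`, hence the sum of squares of its row, which
  -- includes `s * s`.
  have : s * s ≤ s := by
    conv_rhs => rw [← h]
    rw [← hjj]
    exact Finset.single_le_sum (f := fun l => (A.transpose * A) j l * (A.transpose * A) j l)
      (fun l _ => mul_self_nonneg _) (Finset.mem_univ j)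
  nlinarith

/-! ### Recursive bounds and finiteness of the maximal volume -/

theorem maxCubeImageVolume_succ_succ_le (k n : ℕ) :
    maxCubeImageVolume (k + 1) (n + 1) ≤
      maxCubeImageVolume k n + maxCubeImageVolume (k + 1) n := by
  refine iSup₂_le fun A hA => (cubeImageVolume_le_column_norm hA 0).trans ?_
  gcongr
  refine mul_le_of_le_one_left zero_le ?_
  rw [ENNReal.ofReal_le_one]
  exact Real.sqrt_le_one.2 (sum_sq_column_le_one hA 0)

/-- The matrix `diag(1, A)`. -/
def Matrix.consOne {k n : ℕ} (A : Matrix (Fin k) (Fin n) ℝ) :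
    Matrix (Fin (k + 1)) (Fin (n + 1)) ℝ :=
  Matrix.of (Fin.cons (Fin.cons 1 0) fun i => Fin.cons 0 (A i))

theorem Matrix.consOne_mul_transpose {k n : ℕ} {A : Matrix (Fin k) (Fin n) ℝ}
    (hA : A * A.transpose = 1) : A.consOne * A.consOne.transpose = 1 := by
  rw [Matrix.mul_transpose_eq_one_iff] at hA ⊢
  intro i j
  refine Fin.cases ?_ (fun i => ?_) i <;> refine Fin.cases ?_ (fun j => ?_) j <;>
    simp [Matrix.consOne, Fin.sum_univ_succ, hA, Fin.succ_ne_zero, (Fin.succ_ne_zero _).symm]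

theorem cubeImageVolume_le_consOne {k n : ℕ} (A : Matrix (Fin k) (Fin n) ℝ) :
    cubeImageVolume A ≤ cubeImageVolume A.consOne := by
  rw [cubeImageVolume_expand A.consOne (by simp [Matrix.consOne]) (by simp [Matrix.consOne])]
  refine le_trans ?_ le_self_add
  have : A.consOne.submatrix Fin.succ Fin.succ = A := by
    ext i j; simp [Matrix.consOne]
  rw [this]
  simp [Matrix.consOne]

theorem maxCubeImageVolume_le_succ_succ (k n : ℕ) :
    maxCubeImageVolume k n ≤ maxCubeImageVolume (k + 1) (n + 1) :=
  iSup₂_le fun A hA => (cubeImageVolume_le_consOne A).trans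
    (cubeImageVolume_le_max (Matrix.consOne_mul_transpose hA))

theorem maxCubeImageVolume_self (k : ℕ) : maxCubeImageVolume k k = 1 := by
  have h1 : cubeImageVolume (1 : Matrix (Fin k) (Fin k) ℝ) = 1 := by
    simp [cubeImageVolume, Real.volume_Icc_pi]
  refine le_antisymm (iSup₂_le fun A hA => ?_) (h1 ▸ cubeImageVolume_le_max (by simp))
  have := cubeImageVolume_mul A (1 : Matrix (Fin k) (Fin k) ℝ)
  rw [Matrix.mul_one, h1, Matrix.abs_det_of_mul_transpose_eq_one hA] at this
  simp [this]

theorem maxCubeImageVolume_eq_zero_of_lt {k n : ℕ} (h : n < k) : maxCubeImageVolume k n = 0 := by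
  rw [maxCubeImageVolume, ← le_zero_iff]
  refine iSup₂_le fun A hA => absurd ?_ h.not_ge
  have h1 := Matrix.rank_mul_le_left A A.transpose
  rw [hA, Matrix.rank_one, Fintype.card_fin] at h1
  simpa using h1.trans A.rank_le_width

theorem maxCubeImageVolume_lt_top (k n : ℕ) : maxCubeImageVolume k n < ⊤ := by
  induction n generalizing k with
  | zero =>
    rcases k with _ | k
    · simp [maxCubeImageVolume_self]
    · simp [maxCubeImageVolume_eq_zero_of_lt (Nat.succ_pos k)]
  | succ n ih =>
    rcases k with _ | k
    · refine lt_of_le_of_lt (iSup₂_le fun A _ => measure_mono (Set.subset_univ _)) ?_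
      simp [Measure.volume_pi_eq_dirac 0]
    · exact (maxCubeImageVolume_succ_succ_le k n).trans_lt (ENNReal.add_lt_top.2 ⟨ih _, ih _⟩)

/-! ### Growth by √m when the codimension rises by one -/

/-- Extending a matrix with orthonormal rows by one dimension, tilting the first row. -/
theorem exists_tilted_extension {k n : ℕ} {Q : Matrix (Fin (k + 1)) (Fin n) ℝ}
    (hQ : Q * Q.transpose = 1) {a c : ℝ} (ha : 0 ≤ a) (hc : 0 ≤ c) (hac : a ^ 2 + c ^ 2 = 1) :
    ∃ R : Matrix (Fin (k + 2)) (Fin (n + 1)) ℝ, R * R.transpose = 1 ∧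
      cubeImageVolume Q ≤ cubeImageVolume R ∧
      cubeImageVolume (R.submatrix Fin.succ id) =
        ENNReal.ofReal a * cubeImageVolume (Q.submatrix Fin.succ id) +
        ENNReal.ofReal c * cubeImageVolume Q := by
  -- The first two rows of `diag(1, Q)` are rotated in their plane: the row space is unchanged, but
  -- dropping the first row now leaves a mixture.
  set R : Matrix (Fin (k + 2)) (Fin (n + 1)) ℝ :=
    Matrix.of (Fin.cons (Fin.cons (-c) fun l => a * Q 0 l)
      (Fin.cons (Fin.cons a fun l => c * Q 0 l) fun i => Fin.cons 0 (Q i.succ))) with hR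
  have hQ' := Matrix.mul_transpose_eq_one_iff.1 hQ
  have hab (x y : ℝ) (i j) : ∑ l, x * Q i l * (y * Q j l) = x * y * ∑ l, Q i l * Q j l := by
    rw [Finset.mul_sum]; exact Finset.sum_congr rfl fun l _ => by ring
  have hab1 (x : ℝ) (i j) : ∑ l, x * Q i l * Q j l = x * ∑ l, Q i l * Q j l := by
    rw [Finset.mul_sum]; exact Finset.sum_congr rfl fun l _ => by ring
  have hab2 (x : ℝ) (i j) : ∑ l, Q i l * (x * Q j l) = x * ∑ l, Q i l * Q j l := by
    rw [Finset.mul_sum]; exact Finset.sum_congr rfl fun l _ => by ring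
  have hRR : R * R.transpose = 1 := by
    rw [Matrix.mul_transpose_eq_one_iff]
    intro i j
    refine Fin.cases ?_ (fun i => Fin.cases ?_ (fun i => ?_) i) i <;>
      refine Fin.cases ?_ (fun j => Fin.cases ?_ (fun j => ?_) j) j <;>
      simp [hR, Fin.sum_univ_succ, hab, hab1, hab2, hQ', Fin.succ_ne_zero,
        (Fin.succ_ne_zero _).symm, -Fin.succ_zero_eq_one] <;>
      first
        | nlinarith
        | simp [Fin.ext_iff]
  refine ⟨R, hRR, (cubeImageVolume_le_consOne Q).trans_eq
    (cubeImageVolume_eq_of_gram_eq (Matrix.consOne_mul_transpose hQ) ?_), ?_⟩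
  · ext i j
    simp only [Matrix.mul_apply, Matrix.transpose_apply]
    refine Fin.cases ?_ (fun i => ?_) i <;> refine Fin.cases ?_ (fun j => ?_) j <;>
      simp [hR, Matrix.consOne, Fin.sum_univ_succ, -Fin.succ_zero_eq_one] <;>
      first
        | linear_combination -hac
        | linear_combination -(Q 0 i * Q 0 j) * hac
        | ring
  · rw [cubeImageVolume_expand _ (by simp [hR]) (by simpa [hR] using ha)]
    have h1 : (R.submatrix Fin.succ id).submatrix id Fin.succ =
        Matrix.diagonal (Fin.cons c (fun _ : Fin k => (1 : ℝ)) : Fin (k + 1) → ℝ) * Q := by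
      ext i l
      rw [Matrix.diagonal_mul]
      refine Fin.cases ?_ (fun i => ?_) i <;> simp [hR]
    have h2 : (R.submatrix Fin.succ id).submatrix Fin.succ Fin.succ =
        Q.submatrix Fin.succ id := by
      ext i l; simp [hR]
    rw [h1, h2, cubeImageVolume_mul]
    simp [hR, Matrix.det_diagonal, Fin.prod_univ_succ, abs_of_nonneg hc]

theorem exists_sqrt_mul_le_tail {k n : ℕ} {Q : Matrix (Fin (k + 1)) (Fin n) ℝ}
    (hQ : Q * Q.transpose = 1) (m : ℕ) :
    ∃ R : Matrix (Fin (k + m + 1)) (Fin (n + m)) ℝ, R * R.transpose = 1 ∧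
      cubeImageVolume Q ≤ cubeImageVolume R ∧
      ENNReal.ofReal √m * cubeImageVolume Q ≤ cubeImageVolume (R.submatrix Fin.succ id) := by
  induction m with
  | zero => exact ⟨Q, hQ, le_rfl, by simp⟩
  | succ m ih =>
    obtain ⟨R, hR, h1, h2⟩ := ih
    have hm : (0 : ℝ) < m + 1 := by positivity
    have hs : √((m : ℝ) + 1) ^ 2 = m + 1 := Real.sq_sqrt hm.le
    have hs0 : 0 < √((m : ℝ) + 1) := Real.sqrt_pos.2 hm
    have hm2 : √(m : ℝ) ^ 2 = m := Real.sq_sqrt (by positivity)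
    -- By Cauchy–Schwarz this is the choice maximizing `a * √m + c` on the unit circle, with value
    -- `√(m + 1)`.
    obtain ⟨T, hT, h3, h4⟩ := exists_tilted_extension hR (a := √m / √((m : ℝ) + 1))
      (c := 1 / √((m : ℝ) + 1)) (by positivity) (by positivity)
      (by rw [div_pow, div_pow, hs, hm2]; field_simp)
    refine ⟨T, hT, h1.trans h3, ?_⟩
    have he : √((m + 1 : ℕ) : ℝ) = √m / √((m : ℝ) + 1) * √m + 1 / √((m : ℝ) + 1) := by
      push_cast
      field_simp
      rw [hs, hm2]
    refine le_trans ?_ h4.ge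
    rw [he, ENNReal.ofReal_add (by positivity) (by positivity), add_mul,
      ENNReal.ofReal_mul (by positivity), mul_assoc]
    gcongr

theorem sqrt_mul_maxCubeImageVolume_le (k n m : ℕ) :
    ENNReal.ofReal √m * maxCubeImageVolume (k + 1) n ≤ maxCubeImageVolume (k + m) (n + m) := by
  rw [maxCubeImageVolume, ENNReal.mul_iSup]
  refine iSup_le fun Q => ?_
  rw [ENNReal.mul_iSup]
  refine iSup_le fun hQ => ?_
  obtain ⟨R, hR, -, h⟩ := exists_sqrt_mul_le_tail hQ m
  refine h.trans (cubeImageVolume_le_max ?_)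
  rw [Matrix.mul_transpose_eq_one_iff] at hR ⊢
  intro i j
  simpa using hR i.succ j.succ

/-! ### From subspaces to matrices and back -/

theorem cubeProjVolume_eq_cubeImageVolume {k n : ℕ}
    {H : Submodule ℝ (EuclideanSpace ℝ (Fin n))} (b : OrthonormalBasis (Fin k) ℝ H) :
    cubeProjVolume H =
      cubeImageVolume (Matrix.of fun i j => (b i : EuclideanSpace ℝ (Fin n)) j) := by
  have hmp : MeasurePreserving (fun x : H => WithLp.ofLp (b.repr x)) :=
    (PiLp.volume_preserving_ofLp (Fin k)).comp b.measurePreserving_repr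
  have he : MeasurableEmbedding (fun x : H => WithLp.ofLp (b.repr x)) :=
    (MeasurableEquiv.toLp 2 (Fin k → ℝ)).symm.measurableEmbedding.comp
      b.repr.toHomeomorph.measurableEmbedding
  have hinj := he.injective
  rw [cubeProjVolume, ← Set.preimage_image_eq (H.orthogonalProjectionOnto '' unitCube n) hinj,
    hmp.measure_preimage_emb he, cubeImageVolume]
  congr 1
  ext y
  have key (x : EuclideanSpace ℝ (Fin n)) :
      WithLp.ofLp (b.repr (H.orthogonalProjectionOnto x)) =
      (Matrix.of fun i j => (b i : EuclideanSpace ℝ (Fin n)) j).mulVec x.ofLp := by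
    ext i
    rw [b.repr_apply_apply, Submodule.inner_orthogonalProjectionOnto_eq_of_mem_left]
    simp [PiLp.inner_apply, Matrix.mulVec, dotProduct, mul_comm]
  constructor
  · rintro ⟨_, ⟨x, hx, rfl⟩, rfl⟩
    exact ⟨x.ofLp, ⟨fun i => (hx i).1, fun i => (hx i).2⟩, (key x).symm⟩
  · rintro ⟨x, hx, rfl⟩
    exact ⟨_, ⟨WithLp.toLp 2 x, fun i => ⟨hx.1 i, hx.2 i⟩, rfl⟩, key _⟩

theorem OrthonormalBasis.matrix_mul_transpose {k n : ℕ}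
    {H : Submodule ℝ (EuclideanSpace ℝ (Fin n))} (b : OrthonormalBasis (Fin k) ℝ H) :
    (Matrix.of fun i j => (b i : EuclideanSpace ℝ (Fin n)) j) *
      (Matrix.of fun i j => (b i : EuclideanSpace ℝ (Fin n)) j).transpose = 1 := by
  rw [Matrix.mul_transpose_eq_one_iff]
  intro i j
  rw [← orthonormal_iff_ite.1 b.orthonormal i j, Submodule.coe_inner]
  simp [PiLp.inner_apply, mul_comm]

theorem projBasisLength_eq_sqrt {k n : ℕ}
    {H : Submodule ℝ (EuclideanSpace ℝ (Fin n))} (b : OrthonormalBasis (Fin k) ℝ H) (j : Fin n) :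
    projBasisLength H j = √(∑ i, (b i : EuclideanSpace ℝ (Fin n)) j ^ 2) := by
  rw [projBasisLength, ← b.repr.norm_map, EuclideanSpace.norm_eq]
  congr 1
  refine Finset.sum_congr rfl fun i _ => ?_
  rw [b.repr_apply_apply, Submodule.inner_orthogonalProjectionOnto_eq_of_mem_left]
  simp [PiLp.inner_apply]

theorem exists_submodule_cubeProjVolume_eq {k n : ℕ} {A : Matrix (Fin k) (Fin n) ℝ}
    (hA : A * A.transpose = 1) :
    ∃ H : Submodule ℝ (EuclideanSpace ℝ (Fin n)), Module.finrank ℝ H = k ∧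
      cubeProjVolume H = cubeImageVolume A := by
  rw [Matrix.mul_transpose_eq_one_iff] at hA
  set v : Fin k → EuclideanSpace ℝ (Fin n) := fun i => WithLp.toLp 2 (A i) with hv
  have hvo : Orthonormal ℝ v := by
    rw [orthonormal_iff_ite]
    intro i j
    rw [← hA i j]
    simp [hv, PiLp.inner_apply, mul_comm]
  set H := Submodule.span ℝ (Set.range v) with hH
  have hfin : Module.finrank ℝ H = k := by
    rw [hH, finrank_span_eq_card hvo.linearIndependent, Fintype.card_fin]
  set w : Fin k → H := fun i => ⟨v i, Submodule.subset_span ⟨i, rfl⟩⟩ with hw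
  have hwo : Orthonormal ℝ w := by
    rw [orthonormal_iff_ite] at hvo ⊢
    exact hvo
  have hws : Orthonormal ℝ (Set.domRestrict (Set.univ) w) :=
    hwo.comp _ Subtype.val_injective
  obtain ⟨b, hb⟩ := hws.exists_orthonormalBasis_extension_of_card_eq
    (hfin.trans (Fintype.card_fin k).symm)
  refine ⟨H, hfin, ?_⟩
  rw [cubeProjVolume_eq_cubeImageVolume b]
  congr 1
  ext i j
  simp [hb i (Set.mem_univ i), hw, hv]

theorem exists_orthonormalBasis_fin_of_finrank_eq {k n : ℕ}
    {H : Submodule ℝ (EuclideanSpace ℝ (Fin n))} (h : Module.finrank ℝ H = k) :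
    Nonempty (OrthonormalBasis (Fin k) ℝ H) := by
  subst h
  exact ⟨stdOrthonormalBasis ℝ H⟩

theorem IsCubeProjMaximizer.cubeProjVolume_eq {k n : ℕ}
    {H : Submodule ℝ (EuclideanSpace ℝ (Fin n))} (hH : IsCubeProjMaximizer k H) :
    cubeProjVolume H = maxCubeImageVolume k n := by
  obtain ⟨b⟩ := exists_orthonormalBasis_fin_of_finrank_eq hH.1
  refine le_antisymm ?_ (iSup₂_le fun A hA => ?_)
  · rw [cubeProjVolume_eq_cubeImageVolume b]
    exact cubeImageVolume_le_max b.matrix_mul_transpose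
  · obtain ⟨H', h1, h2⟩ := exists_submodule_cubeProjVolume_eq hA
    exact h2 ▸ hH.2 H' h1

/-! ### Asymptotics in fixed codimension -/

/-- The largest volume of a `k`-dimensional projection of the cube `[0,1]^(k+p)`, as a real. -/
noncomputable def codimMaxVolume (p k : ℕ) : ℝ := (maxCubeImageVolume k (k + p)).toReal

theorem codimMaxVolume_le_succ (p k : ℕ) : codimMaxVolume p k ≤ codimMaxVolume p (k + 1) := by
  refine ENNReal.toReal_mono (maxCubeImageVolume_lt_top _ _).ne ?_
  rw [Nat.add_right_comm]
  exact maxCubeImageVolume_le_succ_succ _ _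

theorem codimMaxVolume_pos (p k : ℕ) : 0 < codimMaxVolume p k := by
  induction k with
  | zero =>
    refine ENNReal.toReal_pos (ne_of_gt (lt_of_lt_of_le ?_ (cubeImageVolume_le_max (A := 0)
      (Subsingleton.elim _ _)))) (maxCubeImageVolume_lt_top _ _).ne
    simp [cubeImageVolume, Measure.volume_pi_eq_dirac 0]
  | succ k ih => exact ih.trans_le (codimMaxVolume_le_succ p k)

theorem codimMaxVolume_succ_le (p k : ℕ) :
    codimMaxVolume (p + 1) (k + 1) ≤ codimMaxVolume (p + 1) k + codimMaxVolume p (k + 1) := by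
  rw [codimMaxVolume, codimMaxVolume, codimMaxVolume,
    ← ENNReal.toReal_add (maxCubeImageVolume_lt_top _ _).ne (maxCubeImageVolume_lt_top _ _).ne]
  refine ENNReal.toReal_mono (ENNReal.add_lt_top.2
    ⟨maxCubeImageVolume_lt_top _ _, maxCubeImageVolume_lt_top _ _⟩).ne ?_
  rw [Nat.add_right_comm k 1 p]
  exact maxCubeImageVolume_succ_succ_le k (k + 1 + p) |>.trans_eq (by
    rw [Nat.add_right_comm k 1 p]; rfl)

theorem sqrt_mul_codimMaxVolume_le (p k m : ℕ) :
    √m * codimMaxVolume p (k + 1) ≤ codimMaxVolume (p + 1) (k + m) := by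
  have h := ENNReal.toReal_mono (maxCubeImageVolume_lt_top _ _).ne
    (sqrt_mul_maxCubeImageVolume_le k (k + 1 + p) m)
  rw [ENNReal.toReal_mul, ENNReal.toReal_ofReal (Real.sqrt_nonneg _),
    show k + 1 + p + m = k + m + (p + 1) by ring] at h
  exact h

theorem tendsto_codimMaxVolume_add_div {p : ℕ}
    (h : Tendsto (fun k => codimMaxVolume p (k + 1) / codimMaxVolume p k) atTop (𝓝 1)) (m : ℕ) :
    Tendsto (fun k => codimMaxVolume p (k + m) / codimMaxVolume p k) atTop (𝓝 1) := by
  induction m with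
  | zero => simp [div_self (codimMaxVolume_pos p _).ne']
  | succ m ih =>
    have := ((tendsto_add_atTop_iff_nat m).2 h).mul ih
    rw [one_mul] at this
    refine this.congr fun k => ?_
    rw [div_mul_div_cancel₀ (codimMaxVolume_pos p _).ne', add_assoc]

theorem tendsto_codimMaxVolume_div_codim_succ {p : ℕ}
    (h : Tendsto (fun k => codimMaxVolume p (k + 1) / codimMaxVolume p k) atTop (𝓝 1)) :
    Tendsto (fun k => codimMaxVolume p (k + 1) / codimMaxVolume (p + 1) k) atTop (𝓝 0) := by
  rw [tendsto_order]
  refine ⟨fun a ha => Eventually.of_forall fun k => ha.trans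
    (div_pos (codimMaxVolume_pos _ _) (codimMaxVolume_pos _ _)), fun ε hε => ?_⟩
  -- Then `√m * ε > 2`, which absorbs the factor 2 allowed for the growth over `m` steps.
  obtain ⟨m, hm⟩ := exists_nat_gt ((2 / ε) ^ 2)
  have hsm : 2 / ε < √m := Real.lt_sqrt_of_sq_lt hm
  have hev := (tendsto_order.1 ((tendsto_add_atTop_iff_nat 1).2
    (tendsto_codimMaxVolume_add_div h m))).2 2 one_lt_two
  rw [← map_add_atTop_eq_nat m, eventually_map]
  filter_upwards [hev] with k hk
  have h1 := codimMaxVolume_pos p (k + 1)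
  rw [div_lt_iff₀ h1] at hk
  rw [div_lt_iff₀ (codimMaxVolume_pos _ _)]
  have h2 := sqrt_mul_codimMaxVolume_le p k m
  rw [div_lt_iff₀ hε] at hsm
  rw [Nat.add_right_comm]
  calc codimMaxVolume p (k + 1 + m) < 2 * codimMaxVolume p (k + 1) := hk
    _ ≤ √m * ε * codimMaxVolume p (k + 1) := by gcongr
    _ = ε * (√m * codimMaxVolume p (k + 1)) := by ring
    _ ≤ _ := by gcongr

theorem tendsto_codimMaxVolume_succ_div (p : ℕ) :
    Tendsto (fun k => codimMaxVolume p (k + 1) / codimMaxVolume p k) atTop (𝓝 1) := by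
  induction p with
  | zero => simp [codimMaxVolume, maxCubeImageVolume_self]
  | succ p ih =>
    have h := (tendsto_codimMaxVolume_div_codim_succ ih).const_add 1
    rw [add_zero] at h
    refine tendsto_of_tendsto_of_tendsto_of_le_of_le tendsto_const_nhds h (fun k => ?_) fun k => ?_
    · exact (one_le_div (codimMaxVolume_pos _ _)).2 (codimMaxVolume_le_succ _ _)
    · have h0 := codimMaxVolume_pos (p + 1) k
      simp only
      rw [div_le_iff₀ h0, add_mul, one_mul, div_mul_cancel₀ _ h0.ne']
      exact codimMaxVolume_succ_le p k

theorem tendsto_maxCubeImageVolume_succ_div (q : ℕ) :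
    Tendsto (fun k => (maxCubeImageVolume (k + 1) (k + q)).toReal / codimMaxVolume q k)
      atTop (𝓝 0) := by
  rcases q with _ | p
  -- In codimension zero the numerator asks for more orthonormal rows than columns, so it vanishes.
  · simp [maxCubeImageVolume_eq_zero_of_lt]
  · refine (tendsto_codimMaxVolume_div_codim_succ (tendsto_codimMaxVolume_succ_div p)).congr
      fun k => ?_
    rw [codimMaxVolume, Nat.add_right_comm]
    rfl

/-! ### Lengths of the projected basis vectors -/

theorem projBasisLength_le_one {n : ℕ} (H : Submodule ℝ (EuclideanSpace ℝ (Fin n)))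
    (j : Fin n) : projBasisLength H j ≤ 1 := by
  rw [projBasisLength_eq_sqrt (stdOrthonormalBasis ℝ H)]
  exact Real.sqrt_le_one.2 (sum_sq_column_le_one (stdOrthonormalBasis ℝ H).matrix_mul_transpose j)

theorem IsCubeProjMaximizer.le_projBasisLength {q k n : ℕ} (hn : n = k + q + 1)
    {H : Submodule ℝ (EuclideanSpace ℝ (Fin n))} (hH : IsCubeProjMaximizer (k + 1) H)
    (j : Fin n) :
    1 - (maxCubeImageVolume (k + 1) (k + q)).toReal / codimMaxVolume q k ≤
      projBasisLength H j := by
  subst hn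
  obtain ⟨b⟩ := exists_orthonormalBasis_fin_of_finrank_eq hH.1
  have h := cubeImageVolume_le_column_norm b.matrix_mul_transpose j
  have hl := projBasisLength_eq_sqrt b j
  simp only [Matrix.of_apply] at h
  rw [← hl, ← cubeProjVolume_eq_cubeImageVolume b, hH.cubeProjVolume_eq] at h
  have h' := (maxCubeImageVolume_le_succ_succ k (k + q)).trans h
  have hf1 : ENNReal.ofReal (projBasisLength H j) * maxCubeImageVolume k (k + q) ≠ ⊤ :=
    ENNReal.mul_ne_top ENNReal.ofReal_ne_top (maxCubeImageVolume_lt_top _ _).ne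
  have hf2 := (maxCubeImageVolume_lt_top (k + 1) (k + q)).ne
  have h3 := ENNReal.toReal_mono (ENNReal.add_ne_top.2 ⟨hf1, hf2⟩) h'
  rw [ENNReal.toReal_add hf1 hf2, ENNReal.toReal_mul,
    ENNReal.toReal_ofReal (hl ▸ Real.sqrt_nonneg _)] at h3
  have h0 := codimMaxVolume_pos q k
  rw [sub_le_iff_le_add, ← sub_le_iff_le_add', le_div_iff₀ h0]
  have : codimMaxVolume q k ≤ projBasisLength H j * codimMaxVolume q k +
    (maxCubeImageVolume (k + 1) (k + q)).toReal := h3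
  linarith

theorem corollary2 (q : ℕ) (H : (n : ℕ) → Submodule ℝ (EuclideanSpace ℝ (Fin n)))
    (hH : ∀ n, q ≤ n → IsCubeProjMaximizer (n - q) (H n)) :
    Tendsto (fun n : ℕ => minProjLength (H n) / maxProjLength (H n)) atTop (𝓝 1) := by
  -- The shift is `q + 1` because the maximizer has dimension `n - q = k + 1`.
  have hlim := ((tendsto_maxCubeImageVolume_succ_div q).comp
    (tendsto_sub_atTop_nat (q + 1))).const_sub 1
  rw [sub_zero] at hlim
  have hnn (n : ℕ) (i : Fin n) : 0 ≤ projBasisLength (H n) i := norm_nonneg _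
  have hmin (n : ℕ) : 0 ≤ minProjLength (H n) := Real.iInf_nonneg (hnn n)
  have hmax (n : ℕ) : 0 ≤ maxProjLength (H n) := Real.iSup_nonneg (hnn n)
  have hle (n : ℕ) (hn : 0 < n) : minProjLength (H n) ≤ maxProjLength (H n) := by
    have : Nonempty (Fin n) := ⟨⟨0, hn⟩⟩
    exact ciInf_le_ciSup (Set.finite_range _).bddBelow (Set.finite_range _).bddAbove
  refine tendsto_of_tendsto_of_tendsto_of_le_of_le' hlim tendsto_const_nhds ?_ ?_
  · filter_upwards [eventually_ge_atTop (q + 1)] with n hn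
    have : Nonempty (Fin n) := ⟨⟨0, by omega⟩⟩
    obtain ⟨k, hk⟩ := Nat.exists_eq_add_of_le hn
    have hsub : n - (q + 1) = k := by omega
    have hmaxi := hH n (by omega)
    rw [show n - q = k + 1 by omega] at hmaxi
    have h1 : 1 - (maxCubeImageVolume (k + 1) (k + q)).toReal / codimMaxVolume q k ≤
        minProjLength (H n) :=
      le_ciInf fun j => hmaxi.le_projBasisLength (by omega) j
    have h2 : maxProjLength (H n) ≤ 1 := ciSup_le fun j => projBasisLength_le_one _ j
    simp only [Function.comp_apply, hsub]
    refine h1.trans ?_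
    -- If the maximum were 0, so would be the minimum, and the default `0 / 0 = 0` respects the
    -- bound.
    rcases (hmax n).eq_or_lt with h | h
    · have := hle n (by omega)
      rw [← h] at this ⊢
      simpa using this
    · exact le_div_self (hmin n) h h2
  · filter_upwards [eventually_gt_atTop 0] with n hn
    exact div_le_one_of_le₀ (hle n hn) (hmax n)
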